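/- Let $E>0$ and $-1<\nu<\tfrac12$, let $s\in\mathbb{R}\setminus\{0\}$ and $0<\varepsilon<R$. Write $B_r=B_r(0)\subset\mathbb{R}^2$, $e_1=(1,0)$, and let $$\mathscr{B}_{\varepsilon,R}=\{w\in H^2_0(B_R): w=a \text{ in } B_\varepsilon \text{ for some affine function } a\},$$ $$\mathcal{G}(w;B_R)=\frac12\,\frac{1+\nu}{E}\int_{B_R}\big(|\nabla^2w|^2-\nu|\Delta w|^2\big)\,dx .$$ For $0<h<\varepsilon$ define on $\mathscr{B}_{\varepsilon,R}$ the functional $$\mathcal{J}^s_{h,\varepsilon}(w)=\mathcal{G}(w;B_R)+\frac{s}{2\pi(\varepsilon-h)}\int_{\partial B_{\varepsilon-h}}\frac{w(x+\frac h2e_1)-w(x-\frac h2e_1)}{h}\,d\mathcal{H}^1(x),$$ and define $$\mathcal{J}^s_{0,\varepsilon}(w)=\mathcal{G}(w;B_R)+\frac{s}{2\pi\varepsilon}\int_{\partial B_\varepsilon}\partial_{x_1}w\,d\mathcal{H}^1,$$ where $w$ is identified with its continuous representative and $\partial_{x_1}w$ on $\partial B_\varepsilon$ is understood in the sense of traces.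 Then for every $0\le h<\varepsilon$ the functional $\mathcal{J}^s_{h,\varepsilon}$ has a unique minimizer $W^s_{h,\varepsilon}$ in $\mathscr{B}_{\varepsilon,R}$ and, as $h\to0^+$, $$W^s_{h,\varepsilon}\to W^s_{0,\varepsilon}\ \text{ strongly in } H^2(B_R),\qquad \mathcal{J}^s_{h,\varepsilon}(W^s_{h,\varepsilon})\to\mathcal{J}^s_{0,\varepsilon}(W^s_{0,\varepsilon}).$$ -/

import Mathlib

open MeasureTheory Filter Topology Set
open scoped ContDiff

noncomputable section

namespace Dipole

/-- The plane, with its Euclidean norm. -/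
abbrev Plane : Type := EuclideanSpace ℝ (Fin 2)

/-- The coordinate vector `e_i` (`e 0` is the direction of the first coordinate `x₁`). -/
def e (i : Fin 2) : Plane := EuclideanSpace.single i 1

/-- The open disc `B_r(0)`. -/
abbrev disc (r : ℝ) : Set Plane := Metric.ball (0 : Plane) r

/-- The Lebesgue space `L²(Ω)` of classes of functions modulo equality almost everywhere in `Ω`. -/
abbrev L2 (Ω : Set Plane) : Type := Lp ℝ 2 ((volume : Measure Plane).restrict Ω)

/-- `φ ∈ C_c^∞(Ω)`. -/
structure IsTest (Ω : Set Plane) (φ : Plane → ℝ) : Prop where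
  smooth : ContDiff ℝ ∞ φ
  compact : HasCompactSupport φ
  subset : tsupport φ ⊆ Ω

/-- `g` is the weak partial derivative `∂_i u` in `Ω`. -/
def IsWeakPartial (Ω : Set Plane) (i : Fin 2) (u g : L2 Ω) : Prop :=
  ∀ φ : Plane → ℝ, IsTest Ω φ →
    ∫ x in Ω, u x * fderiv ℝ φ x (e i) = - ∫ x in Ω, g x * φ x

open Classical in
/-- The weak partial derivative `∂_i u` (for open `Ω` it is unique when it exists in `L²(Ω)`;
by convention it is `0` if it does not exist). -/
def weakPartial (Ω : Set Plane) (i : Fin 2) (u : L2 Ω) : L2 Ω :=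
  if hu : ∃ g : L2 Ω, IsWeakPartial Ω i u g then hu.choose else 0

/-- The entries `∂_j ∂_i u` of the weak Hessian. -/
def weakHess (Ω : Set Plane) (i j : Fin 2) (u : L2 Ω) : L2 Ω :=
  weakPartial Ω j (weakPartial Ω i u)

/-- The Sobolev space `H²(Ω)`: all weak derivatives up to order two exist in `L²(Ω)`. -/
def H2 (Ω : Set Plane) : Set (L2 Ω) :=
  {u | ∀ i, IsWeakPartial Ω i u (weakPartial Ω i u) ∧
    ∀ j, IsWeakPartial Ω j (weakPartial Ω i u) (weakHess Ω i j u)}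

/-- The norm of `H²(Ω)`. -/
def h2Norm (Ω : Set Plane) (u : L2 Ω) : ℝ :=
  Real.sqrt (‖u‖ ^ 2 + ∑ i, ‖weakPartial Ω i u‖ ^ 2 + ∑ i, ∑ j, ‖weakHess Ω i j u‖ ^ 2)

/-- `H²₀(Ω)`, the closure of `C_c^∞(Ω)` in `H²(Ω)`. -/
def H20 (Ω : Set Plane) : Set (L2 Ω) :=
  {u | u ∈ H2 Ω ∧ ∀ δ > 0, ∃ v : L2 Ω,
    (∃ φ, IsTest Ω φ ∧ v =ᵐ[(volume : Measure Plane).restrict Ω] φ) ∧ h2Norm Ω (u - v) < δ}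

/-- The functions of `H²₀(B_R(0))` that coincide with an affine function in `B_ε(0)`. -/
def coreSpace (ε R : ℝ) : Set (L2 (disc R)) :=
  {w | w ∈ H20 (disc R) ∧
    ∃ a : Plane →ᵃ[ℝ] ℝ, ∀ᵐ x ∂((volume : Measure Plane).restrict (disc ε)), w x = a x}

/-- The bulk elastic energy
`½ (1+ν)/E ∫_Ω (|∇²u|² - ν |Δu|²) dx`. -/
def bulkEnergy (E ν : ℝ) (Ω : Set Plane) (u : L2 Ω) : ℝ :=
  1 / 2 * ((1 + ν) / E) *
    ∫ x in Ω, ((∑ i, ∑ j, weakHess Ω i j u x ^ 2) - ν * (∑ i, weakHess Ω i i u x) ^ 2)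

/-- The pointwise value at `x` of a function known up to null sets in `U`, as the limit of its
mean values over `B_r(x) ∩ U` for `r → 0⁺`.  At an interior point `x` of `U` this is the value of
the continuous representative, whenever there is one; at boundary points of a Lipschitz domain
`U` it is (almost everywhere on `∂U`) the Sobolev trace from `U`. -/
def pointValue (U : Set Plane) (u : Plane → ℝ) (x : Plane) : ℝ :=
  limUnder (𝓝[>] (0 : ℝ)) (fun r => ⨍ y in Metric.ball x r ∩ U, u y)

/-- The rescaled dipole functional (for `0 < h < ε`)
`𝒢(w; B_R) + s / (2π(ε-h)) ∫_{∂B_{ε-h}} (w(x + h/2 e₁) - w(x - h/2 e₁)) / h dℋ¹(x)`. -/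
def dipoleFunctional (E ν s ε R h : ℝ) (w : L2 (disc R)) : ℝ :=
  bulkEnergy E ν (disc R) w +
    s / (2 * Real.pi * (ε - h)) *
      ∫ x in Metric.sphere (0 : Plane) (ε - h),
        (pointValue (disc R) w (x + (h / 2) • e 0)
          - pointValue (disc R) w (x - (h / 2) • e 0)) / h
        ∂(Measure.hausdorffMeasure 1)

/-- The limit functional `𝒢(w; B_R) + s / (2πε) ∫_{∂B_ε} ∂_{x₁} w dℋ¹`; the boundary values of
the `H¹` function `∂_{x₁} w` on `∂B_ε` are its traces. -/
def limitFunctional (E ν s ε R : ℝ) (w : L2 (disc R)) : ℝ :=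
  bulkEnergy E ν (disc R) w +
    s / (2 * Real.pi * ε) *
      ∫ x in Metric.sphere (0 : Plane) ε,
        pointValue (disc ε) (weakPartial (disc R) 0 w) x
        ∂(Measure.hausdorffMeasure 1)

/-- `w` minimizes `J` over the set `S`. -/
def IsMinimizer {X : Type*} (J : X → ℝ) (S : Set X) (w : X) : Prop :=
  w ∈ S ∧ ∀ v ∈ S, J w ≤ J v

end Dipole

end

open Dipole

/-!
Every competitor `w` agrees with an affine function `a` on the disc `B_ε`, and all the boundary
terms only see this disc: for `|x| = ε - h` both points `x ± (h/2) e₁` lie in `B_ε`, so the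
difference quotient is exactly `∂₁a`, and the trace of `∂₁w` on `∂B_ε` from inside is the same
constant.  Since the length of a circle is proportional to its radius
(`hausdorffMeasure_real_sphere`), the circle averages do not depend on the radius either.  Hence on
the competitors all the functionals `𝒥_h`, `0 ≤ h < ε`, are one and the same functional
(`dipoleFunctional_eq_limitFunctional`): the minimizers do not depend on `h`, and both convergences
are convergences of eventually constant functions.

What remains is that this functional has exactly one minimizer (`existsUnique_isMinimizer`).  It is
the energy plus a linear functional, bounded because `∂₁a` is the mean of `∂₁w` over `B_ε`
(`limitFunctional_eq_load`).  Functions are identified with the triples of their derivatives up to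
order two, so that `H²₀` functions that are affine in `B_ε` form a closed subspace of a product of
`L²` spaces (`isClosed_coreJets`).  The energy is coercive there: `|Δw|² ≤ 2|∇²w|²` and `ν < 1/2`
bound it below by the Hessian (`hess_le_energyForm`), and the Poincaré inequality applied to `w` and
to `∇w` bounds the whole `H²` norm by the Hessian (`norm_sq_le_hess`).  The Lax-Milgram theorem then
gives the minimizer.
-/

noncomputable section

namespace Dipole

variable {Ω : Set Plane}

/-! ### Test functions -/

namespace IsTest

variable {φ ψ : Plane → ℝ}

theorem continuous (hφ : IsTest Ω φ) : Continuous φ := hφ.smooth.continuous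

theorem differentiable (hφ : IsTest Ω φ) : Differentiable ℝ φ :=
  hφ.smooth.differentiable (by simp)

theorem mono {Ω' : Set Plane} (hφ : IsTest Ω φ) (h : Ω ⊆ Ω') : IsTest Ω' φ :=
  ⟨hφ.smooth, hφ.compact, hφ.subset.trans h⟩

theorem eq_zero_of_notMem (hφ : IsTest Ω φ) {x : Plane} (hx : x ∉ Ω) : φ x = 0 :=
  image_eq_zero_of_notMem_tsupport fun h => hx (hφ.subset h)

theorem partialDeriv (hφ : IsTest Ω φ) (i : Fin 2) :
    IsTest Ω (fun x => fderiv ℝ φ x (e i)) where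
  smooth := (hφ.smooth.fderiv_right (m := ∞) (by simp)).clm_apply contDiff_const
  compact := hφ.compact.fderiv_apply ℝ (e i)
  subset := (tsupport_fderiv_apply_subset (f := φ) ℝ (e i)).trans hφ.subset

theorem memLp (hφ : IsTest Ω φ) : MemLp φ 2 ((volume : Measure Plane).restrict Ω) :=
  hφ.continuous.memLp_of_hasCompactSupport hφ.compact

/-- The class in `L²(Ω)` of a test function. -/
def toL2 (hφ : IsTest Ω φ) : L2 Ω := hφ.memLp.toLp φ

theorem toL2_ae (hφ : IsTest Ω φ) :
    hφ.toL2 =ᵐ[(volume : Measure Plane).restrict Ω] φ := hφ.memLp.coeFn_toLp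

theorem inner_toL2 (hφ : IsTest Ω φ) (u : L2 Ω) :
    inner ℝ hφ.toL2 u = ∫ x in Ω, u x * φ x := by
  rw [L2.inner_def]
  refine integral_congr_ae ?_
  filter_upwards [hφ.toL2_ae] with x hx
  simp [hx]

theorem inner_toL2_toL2 (hφ : IsTest Ω φ) (hψ : IsTest Ω ψ) :
    inner ℝ hφ.toL2 hψ.toL2 = ∫ x, ψ x * φ x := by
  have h := setIntegral_eq_integral_of_forall_compl_eq_zero (μ := (volume : Measure Plane))
    (s := Ω) (f := fun x => ψ x * φ x) fun x hx => by simp [hφ.eq_zero_of_notMem hx]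
  rw [hφ.inner_toL2, ← h]
  refine integral_congr_ae ?_
  filter_upwards [hψ.toL2_ae] with x hx
  rw [hx]

theorem integrable_mul (hφ : IsTest Ω φ) {f : Plane → ℝ} (hf : Continuous f) :
    Integrable (fun x => f x * φ x) :=
  (hf.mul hφ.continuous).integrable_of_hasCompactSupport hφ.compact.mul_left

/-- Integration by parts. -/
theorem integral_mul_partialDeriv (hφ : IsTest Ω φ) {f : Plane → ℝ} (hf : ContDiff ℝ 1 f)
    (i : Fin 2) :
    ∫ x, f x * fderiv ℝ φ x (e i) = - ∫ x, fderiv ℝ f x (e i) * φ x := by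
  have hf' : Continuous fun x => fderiv ℝ f x (e i) :=
    (hf.continuous_fderiv (by simp)).clm_apply continuous_const
  exact integral_mul_fderiv_eq_neg_fderiv_mul_of_integrable
    (hφ.integrable_mul hf') ((hφ.partialDeriv i).integrable_mul hf.continuous)
    (hφ.integrable_mul hf.continuous) (fun x _ => hf.differentiable (by simp) x)
    (fun x _ => hφ.differentiable x)

/-- The Poincaré inequality for test functions in a disc: integrate `φ² = φ² ∂ᵢxᵢ` by parts and
absorb half of the result by Young's inequality. -/
theorem norm_toL2_le {R : ℝ} (hR : 0 < R) (hφ : IsTest (disc R) φ) (i : Fin 2) :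
    ‖hφ.toL2‖ ≤ 2 * R * ‖(hφ.partialDeriv i).toL2‖ := by
  have key : ∫ x, (x i * φ x) * fderiv ℝ φ x (e i) =
      - ∫ x, (φ x + x i * fderiv ℝ φ x (e i)) * φ x := by
    have hc : ContDiff ℝ ∞ (fun x : Plane => x i) :=
      (EuclideanSpace.proj (𝕜 := ℝ) i).contDiff
    have := hφ.integral_mul_partialDeriv (f := fun x => x i * φ x)
      ((hc.mul hφ.smooth).of_le (by simp)) i
    rw [this]
    congr 2
    ext x
    have h1 : HasFDerivAt (fun x : Plane => x i) (EuclideanSpace.proj (𝕜 := ℝ) i) x :=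
      (EuclideanSpace.proj (𝕜 := ℝ) i).hasFDerivAt
    rw [HasFDerivAt.fderiv (f := fun x : Plane => x i * φ x)
      (h1.mul (hφ.differentiable x).hasFDerivAt)]
    simp [e]
    left
    ring
  have hci : Continuous (fun x : Plane => x i) := (EuclideanSpace.proj (𝕜 := ℝ) i).continuous
  have hd := (hφ.partialDeriv i).continuous
  have i1 : Integrable fun x => φ x * φ x := hφ.integrable_mul hφ.continuous
  have i2 : Integrable fun x => (x i * φ x) * fderiv ℝ φ x (e i) :=
    (hφ.partialDeriv i).integrable_mul (hci.mul hφ.continuous)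
  have i3 : Integrable fun x => fderiv ℝ φ x (e i) * fderiv ℝ φ x (e i) :=
    (hφ.partialDeriv i).integrable_mul hd
  have e1 : ∫ x, φ x * φ x = - (2 * ∫ x, (x i * φ x) * fderiv ℝ φ x (e i)) := by
    have : ∫ x, (φ x + x i * fderiv ℝ φ x (e i)) * φ x =
        (∫ x, φ x * φ x) + ∫ x, (x i * φ x) * fderiv ℝ φ x (e i) := by
      rw [← integral_add i1 i2]
      congr 1
      ext x
      ring
    rw [this] at key
    linarith
  have e2 : ∫ x, φ x * φ x ≤
      ∫ x, (1 / 2 * (φ x * φ x) + 2 * R ^ 2 * (fderiv ℝ φ x (e i) * fderiv ℝ φ x (e i))) := by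
    rw [e1, ← integral_const_mul, ← integral_neg]
    refine integral_mono ((i2.const_mul 2).neg) ((i1.const_mul _).add (i3.const_mul _)) ?_
    intro x
    dsimp only
    by_cases hx : x ∈ disc R
    · have hxi : |x i| ≤ R := by
        have := PiLp.norm_apply_le x i
        have hx' : ‖x‖ < R := by simpa using hx
        rw [Real.norm_eq_abs] at this
        linarith
      have hx2 : x i ^ 2 ≤ R ^ 2 := sq_le_sq' (abs_le.1 hxi).1 (abs_le.1 hxi).2
      have h2 : x i ^ 2 * fderiv ℝ φ x (e i) ^ 2 ≤ R ^ 2 * fderiv ℝ φ x (e i) ^ 2 :=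
        mul_le_mul_of_nonneg_right hx2 (sq_nonneg _)
      nlinarith [sq_nonneg (φ x + 2 * x i * fderiv ℝ φ x (e i))]
    · simp [hφ.eq_zero_of_notMem hx, (hφ.partialDeriv i).eq_zero_of_notMem hx]
  rw [integral_add (i1.const_mul _) (i3.const_mul _), integral_const_mul, integral_const_mul] at e2
  have n1 : ‖hφ.toL2‖ ^ 2 = ∫ x, φ x * φ x := by
    rw [← inner_toL2_toL2 hφ hφ, real_inner_self_eq_norm_sq]
  have n2 : ‖(hφ.partialDeriv i).toL2‖ ^ 2 =
      ∫ x, fderiv ℝ φ x (e i) * fderiv ℝ φ x (e i) := by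
    rw [← inner_toL2_toL2 (hφ.partialDeriv i) (hφ.partialDeriv i), real_inner_self_eq_norm_sq]
  rw [← n1, ← n2] at e2
  refine abs_le_of_sq_le_sq' ?_ (by positivity) |>.2
  nlinarith

end IsTest

/-! ### Weak derivatives -/

/-- Weak derivatives are characterized by linear conditions that are continuous in `L²`; linearity
and closedness of the weak derivative follow from this form. -/
theorem isWeakPartial_iff {i : Fin 2} {u g : L2 Ω} :
    IsWeakPartial Ω i u g ↔ ∀ φ, ∀ hφ : IsTest Ω φ,
      inner ℝ (hφ.partialDeriv i).toL2 u + inner ℝ hφ.toL2 g = 0 := by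
  refine forall_congr' fun φ => forall_congr' fun hφ => ?_
  rw [IsTest.inner_toL2, IsTest.inner_toL2, eq_neg_iff_add_eq_zero]

theorem IsTest.isWeakPartial {φ : Plane → ℝ} (hφ : IsTest Ω φ) (i : Fin 2) :
    IsWeakPartial Ω i hφ.toL2 (hφ.partialDeriv i).toL2 := by
  rw [isWeakPartial_iff]
  intro ψ hψ
  rw [IsTest.inner_toL2_toL2, IsTest.inner_toL2_toL2,
    hψ.integral_mul_partialDeriv (hφ.smooth.of_le (by simp)), neg_add_cancel]

theorem IsWeakPartial.add {i : Fin 2} {u v g k : L2 Ω} (hu : IsWeakPartial Ω i u g)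
    (hv : IsWeakPartial Ω i v k) : IsWeakPartial Ω i (u + v) (g + k) := by
  rw [isWeakPartial_iff] at *
  intro φ hφ
  rw [inner_add_right, inner_add_right]
  linarith [hu φ hφ, hv φ hφ]

theorem IsWeakPartial.smul {i : Fin 2} {u g : L2 Ω} (c : ℝ) (hu : IsWeakPartial Ω i u g) :
    IsWeakPartial Ω i (c • u) (c • g) := by
  rw [isWeakPartial_iff] at *
  intro φ hφ
  rw [inner_smul_right, inner_smul_right, ← mul_add, hu φ hφ, mul_zero]

theorem isWeakPartial_zero (i : Fin 2) : IsWeakPartial Ω i 0 0 := by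
  rw [isWeakPartial_iff]
  simp

theorem locallyIntegrableOn_L2 (u : L2 Ω) : LocallyIntegrableOn u Ω :=
  locallyIntegrableOn_of_locallyIntegrable_restrict ((Lp.memLp u).locallyIntegrable (by norm_num))

theorem IsWeakPartial.unique (hΩ : IsOpen Ω) {i : Fin 2} {u g k : L2 Ω}
    (hg : IsWeakPartial Ω i u g) (hk : IsWeakPartial Ω i u k) : g = k := by
  rw [isWeakPartial_iff] at *
  rw [← sub_eq_zero]
  refine Lp.ext ?_
  refine (EventuallyEq.trans ?_ (Lp.coeFn_zero ℝ 2 _).symm)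
  rw [EventuallyEq, ae_restrict_iff' hΩ.measurableSet]
  refine hΩ.ae_eq_zero_of_integral_contDiff_smul_eq_zero (locallyIntegrableOn_L2 _) ?_
  intro φ h1 h2 h3
  have hφ : IsTest Ω φ := ⟨h1, h2, h3⟩
  have : inner ℝ hφ.toL2 (g - k) = 0 := by
    rw [inner_sub_right]
    linarith [hg φ hφ, hk φ hφ]
  rw [hφ.inner_toL2] at this
  rw [← this, setIntegral_eq_integral_of_forall_compl_eq_zero]
  · simp [mul_comm]
  · intro x hx
    simp [hφ.eq_zero_of_notMem hx]

theorem IsWeakPartial.weakPartial_eq (hΩ : IsOpen Ω) {i : Fin 2} {u g : L2 Ω}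
    (hg : IsWeakPartial Ω i u g) : weakPartial Ω i u = g := by
  have h : ∃ g : L2 Ω, IsWeakPartial Ω i u g := ⟨g, hg⟩
  rw [weakPartial, dif_pos h]
  exact h.choose_spec.unique hΩ hg

/-! ### Jets: the Sobolev space as a closed subspace of a Hilbert space -/

/-- Triples `(u, (gᵢ), (Hᵢⱼ))` of candidates for a function, its gradient and its Hessian, with the
Hilbert norm of the product.  The indices are `none` for the function, `some (inl i)` for `gᵢ` and
`some (inr (i, j))` for `Hᵢⱼ`. -/
abbrev Jet (Ω : Set Plane) : Type := PiLp 2 fun _ : Option (Fin 2 ⊕ Fin 2 × Fin 2) => L2 Ω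

namespace Jet

/-- The function component of a jet. -/
def fn : Jet Ω →L[ℝ] L2 Ω := PiLp.proj 2 _ none

/-- The gradient components of a jet. -/
def grad (i : Fin 2) : Jet Ω →L[ℝ] L2 Ω := PiLp.proj 2 _ (some (.inl i))

/-- The Hessian components of a jet. -/
def hess (i j : Fin 2) : Jet Ω →L[ℝ] L2 Ω := PiLp.proj 2 _ (some (.inr (i, j)))

/-- The jet with the given components. -/
def mk (u : L2 Ω) (g : Fin 2 → L2 Ω) (H : Fin 2 → Fin 2 → L2 Ω) : Jet Ω :=
  WithLp.toLp 2 fun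
    | none => u
    | some (.inl i) => g i
    | some (.inr p) => H p.1 p.2

theorem ext_iff_components {k l : Jet Ω} :
    k = l ↔ fn k = fn l ∧ ∀ i, grad i k = grad i l ∧ ∀ j, hess i j k = hess i j l := by
  refine ⟨by rintro rfl; simp, fun ⟨h0, h⟩ => ?_⟩
  ext1 a
  rcases a with _ | i | ⟨i, j⟩
  · exact h0
  · exact (h i).1
  · exact (h i).2 j

theorem norm_sq (k : Jet Ω) :
    ‖k‖ ^ 2 = ‖fn k‖ ^ 2 + ∑ i, ‖grad i k‖ ^ 2 + ∑ i, ∑ j, ‖hess i j k‖ ^ 2 := by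
  rw [PiLp.norm_sq_eq_of_L2, Fintype.sum_option, Fintype.sum_sum_type, Fintype.sum_prod_type,
    ← add_assoc]
  rfl

/-- The jet of weak derivatives of a function. -/
def of (u : L2 Ω) : Jet Ω := mk u (fun i => weakPartial Ω i u) fun i j => weakHess Ω i j u

theorem norm_of (u : L2 Ω) : ‖of u‖ = h2Norm Ω u := by
  rw [h2Norm, eq_comm, Real.sqrt_eq_iff_eq_sq (by positivity) (norm_nonneg _), norm_sq]
  rfl

end Jet

open Jet

/-- The jets whose components are the weak derivatives of their function component. -/
def sobolevJets (Ω : Set Plane) : Submodule ℝ (Jet Ω) where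
  carrier := {k | ∀ i, IsWeakPartial Ω i (fn k) (grad i k) ∧
    ∀ j, IsWeakPartial Ω j (grad i k) (hess i j k)}
  add_mem' := fun {k l} hk hl i => by
    simp only [map_add]
    exact ⟨(hk i).1.add (hl i).1, fun j => ((hk i).2 j).add ((hl i).2 j)⟩
  zero_mem' := fun i => by
    simp only [map_zero]
    exact ⟨isWeakPartial_zero i, fun j => isWeakPartial_zero j⟩
  smul_mem' := fun c k hk i => by
    simp only [map_smul]
    exact ⟨(hk i).1.smul c, fun j => ((hk i).2 j).smul c⟩

theorem isClosed_isWeakPartial {X : Type*} [TopologicalSpace X] (i : Fin 2) {f g : X → L2 Ω}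
    (hf : Continuous f) (hg : Continuous g) : IsClosed {x | IsWeakPartial Ω i (f x) (g x)} := by
  simp only [isWeakPartial_iff, ofPred_forall]
  refine isClosed_iInter fun φ => isClosed_iInter fun hφ => isClosed_eq ?_ continuous_const
  exact (continuous_const.inner hf).add (continuous_const.inner hg)

theorem isClosed_sobolevJets : IsClosed (sobolevJets Ω : Set (Jet Ω)) := by
  have : (sobolevJets Ω : Set (Jet Ω)) =
      ⋂ i, ({k | IsWeakPartial Ω i (fn k) (grad i k)} ∩
        ⋂ j, {k | IsWeakPartial Ω j (grad i k) (hess i j k)}) := by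
    ext k
    simp [sobolevJets]
  rw [this]
  exact isClosed_iInter fun i => (isClosed_isWeakPartial i fn.continuous (grad i).continuous).inter
    (isClosed_iInter fun j => isClosed_isWeakPartial j (grad i).continuous (hess i j).continuous)

theorem mem_H2_iff {u : L2 Ω} : u ∈ H2 Ω ↔ of u ∈ sobolevJets Ω := Iff.rfl

theorem of_fn (hΩ : IsOpen Ω) {k : Jet Ω} (hk : k ∈ sobolevJets Ω) : of (fn k) = k := by
  rw [Jet.ext_iff_components]
  refine ⟨rfl, fun i => ?_⟩
  have h1 : weakPartial Ω i (fn k) = grad i k := (hk i).1.weakPartial_eq hΩ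
  refine ⟨h1, fun j => ?_⟩
  have : weakHess Ω i j (fn k) = hess i j k := by
    rw [weakHess, h1]
    exact ((hk i).2 j).weakPartial_eq hΩ
  exact this

theorem fn_mem_H2 (hΩ : IsOpen Ω) {k : Jet Ω} (hk : k ∈ sobolevJets Ω) : fn k ∈ H2 Ω := by
  rwa [mem_H2_iff, of_fn hΩ hk]

theorem of_sub (hΩ : IsOpen Ω) {u v : L2 Ω} (hu : u ∈ H2 Ω) (hv : v ∈ H2 Ω) :
    of (u - v) = of u - of v :=
  of_fn hΩ (k := of u - of v) (sub_mem (mem_H2_iff.1 hu) (mem_H2_iff.1 hv))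

/-- The jets of test functions. -/
def testJets (Ω : Set Plane) : Submodule ℝ (Jet Ω) where
  carrier := {k | k ∈ sobolevJets Ω ∧
    ∃ φ, IsTest Ω φ ∧ fn k =ᵐ[(volume : Measure Plane).restrict Ω] φ}
  add_mem' := by
    rintro k l ⟨hk, φ, hφ, hkφ⟩ ⟨hl, ψ, hψ, hlψ⟩
    refine ⟨add_mem hk hl, φ + ψ, ⟨hφ.smooth.add hψ.smooth, hφ.compact.add hψ.compact,
      (tsupport_add φ ψ).trans (union_subset hφ.subset hψ.subset)⟩, ?_⟩
    rw [map_add]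
    exact (Lp.coeFn_add _ _).trans (hkφ.add hlψ)
  zero_mem' := by
    refine ⟨zero_mem _, 0, ⟨contDiff_const, HasCompactSupport.zero, by simp⟩, ?_⟩
    rw [map_zero]
    exact Lp.coeFn_zero _ _ _
  smul_mem' := by
    rintro c k ⟨hk, φ, hφ, hkφ⟩
    refine ⟨Submodule.smul_mem _ c hk, c • φ, ⟨hφ.smooth.const_smul c, hφ.compact.smul_left,
      (closure_mono (Function.support_const_smul_subset c φ)).trans hφ.subset⟩, ?_⟩
    rw [map_smul]
    exact (Lp.coeFn_smul _ _).trans (hkφ.const_smul c)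

theorem closure_testJets_le : (testJets Ω).topologicalClosure ≤ sobolevJets Ω :=
  Submodule.topologicalClosure_minimal _ (fun _ hk => hk.1) isClosed_sobolevJets

theorem IsTest.toL2_mem_H2 (hΩ : IsOpen Ω) {φ : Plane → ℝ} (hφ : IsTest Ω φ) :
    hφ.toL2 ∈ H2 Ω :=
  fn_mem_H2 hΩ (k := Jet.mk hφ.toL2 (fun i => (hφ.partialDeriv i).toL2)
    fun i j => ((hφ.partialDeriv i).partialDeriv j).toL2)
    fun i => ⟨hφ.isWeakPartial i, (hφ.partialDeriv i).isWeakPartial⟩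

theorem mem_H20_iff (hΩ : IsOpen Ω) {u : L2 Ω} :
    u ∈ H20 Ω ↔ of u ∈ (testJets Ω).topologicalClosure := by
  rw [← SetLike.mem_coe, Submodule.topologicalClosure_coe, Metric.mem_closure_iff]
  constructor
  · rintro ⟨hu, h⟩ δ hδ
    obtain ⟨v, ⟨φ, hφ, hv⟩, hd⟩ := h δ hδ
    have hvφ : v = hφ.toL2 := Lp.ext (hv.trans hφ.toL2_ae.symm)
    have hvH : v ∈ H2 Ω := hvφ ▸ hφ.toL2_mem_H2 hΩ
    refine ⟨of v, ⟨mem_H2_iff.1 hvH, φ, hφ, hv⟩, ?_⟩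
    rwa [dist_eq_norm, ← of_sub hΩ hu hvH, norm_of]
  · intro h
    have hu : u ∈ H2 Ω := by
      rw [mem_H2_iff]
      refine closure_testJets_le ?_
      rw [← SetLike.mem_coe, Submodule.topologicalClosure_coe, Metric.mem_closure_iff]
      exact h
    refine ⟨hu, fun δ hδ => ?_⟩
    obtain ⟨k, ⟨hk, φ, hφ, hkφ⟩, hd⟩ := h δ hδ
    refine ⟨fn k, ⟨φ, hφ, hkφ⟩, ?_⟩
    rwa [← norm_of, of_sub hΩ hu (fn_mem_H2 hΩ hk), of_fn hΩ hk, ← dist_eq_norm]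

/-- The Poincaré inequality in `H²₀` of a disc: the Hessian controls the whole jet. -/
theorem norm_sq_le_hess {R : ℝ} (hR : 0 < R) {k : Jet (disc R)}
    (hk : k ∈ (testJets (disc R)).topologicalClosure) :
    ‖k‖ ^ 2 ≤ (16 * R ^ 4 + 4 * R ^ 2 + 1) * ∑ i, ∑ j, ‖hess i j k‖ ^ 2 := by
  have main : (testJets (disc R) : Set (Jet (disc R))) ⊆
      {k | ‖fn k‖ ≤ 2 * R * ‖grad 0 k‖ ∧ ∀ i, ‖grad i k‖ ≤ 2 * R * ‖hess i i k‖} := by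
    rintro k ⟨hk, φ, hφ, hkφ⟩
    have h0 : fn k = hφ.toL2 := Lp.ext (hkφ.trans hφ.toL2_ae.symm)
    have h1 : ∀ i, grad i k = (hφ.partialDeriv i).toL2 := fun i =>
      (h0 ▸ (hk i).1).unique Metric.isOpen_ball (hφ.isWeakPartial i)
    have h2 : ∀ i, hess i i k = ((hφ.partialDeriv i).partialDeriv i).toL2 := fun i =>
      (h1 i ▸ (hk i).2 i).unique Metric.isOpen_ball ((hφ.partialDeriv i).isWeakPartial i)
    refine ⟨?_, fun i => ?_⟩
    · rw [h0, h1]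
      exact hφ.norm_toL2_le hR 0
    · rw [h1, h2]
      exact (hφ.partialDeriv i).norm_toL2_le hR i
  have hcl : IsClosed {k : Jet (disc R) |
      ‖fn k‖ ≤ 2 * R * ‖grad 0 k‖ ∧ ∀ i, ‖grad i k‖ ≤ 2 * R * ‖hess i i k‖} := by
    rw [ofPred_and, ofPred_forall]
    refine (isClosed_le (by fun_prop) (by fun_prop)).inter
      (isClosed_iInter fun i => isClosed_le (by fun_prop) (by fun_prop))
  obtain ⟨h0, h1⟩ := closure_minimal main hcl hk
  have s0 : ‖fn k‖ ^ 2 ≤ (2 * R) ^ 2 * ‖grad 0 k‖ ^ 2 := by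
    rw [← mul_pow]; gcongr
  have s1 : ∀ i, ‖grad i k‖ ^ 2 ≤ (2 * R) ^ 2 * ‖hess i i k‖ ^ 2 := fun i => by
    rw [← mul_pow]; gcongr; exact h1 i
  have s2 : (2 * R) ^ 2 * ‖grad 0 k‖ ^ 2 ≤ (2 * R) ^ 2 * ((2 * R) ^ 2 * ‖hess 0 0 k‖ ^ 2) := by
    gcongr; exact s1 0
  have p1 := s1 0
  have p2 := s1 1
  have q1 : 0 ≤ R ^ 2 * ‖hess 0 1 k‖ ^ 2 := by positivity
  have q2 : 0 ≤ R ^ 2 * ‖hess 1 0 k‖ ^ 2 := by positivity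
  have q3 : 0 ≤ R ^ 4 * ‖hess 0 1 k‖ ^ 2 := by positivity
  have q4 : 0 ≤ R ^ 4 * ‖hess 1 0 k‖ ^ 2 := by positivity
  have q5 : 0 ≤ R ^ 4 * ‖hess 1 1 k‖ ^ 2 := by positivity
  rw [Jet.norm_sq]
  simp only [Fin.sum_univ_two]
  linarith

/-! ### The space of competitors -/

instance isFiniteMeasure_restrict_disc (r : ℝ) :
    IsFiniteMeasure ((volume : Measure Plane).restrict (disc r)) :=
  isFiniteMeasure_restrict.2 measure_ball_lt_top.ne

theorem memLp_affine (ε R : ℝ) (a : Plane →ᵃ[ℝ] ℝ) :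
    MemLp a 2 (((volume : Measure Plane).restrict (disc R)).restrict (disc ε)) := by
  obtain ⟨C, hC⟩ := (isCompact_closedBall (0 : Plane) ε).exists_bound_of_continuousOn
    a.continuous_of_finiteDimensional.continuousOn
  refine MemLp.of_bound a.continuous_of_finiteDimensional.aestronglyMeasurable C ?_
  filter_upwards [ae_restrict_mem Metric.isOpen_ball.measurableSet] with x hx
  exact hC x (Metric.ball_subset_closedBall hx)

/-- Affine functions restricted to the inner disc, as elements of `L²`. -/
def affineL2 (ε R : ℝ) : (Plane →ᵃ[ℝ] ℝ) →ₗ[ℝ]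
    Lp ℝ 2 (((volume : Measure Plane).restrict (disc R)).restrict (disc ε)) where
  toFun a := (memLp_affine ε R a).toLp a
  map_add' a b := MemLp.toLp_add (memLp_affine ε R a) (memLp_affine ε R b)
  map_smul' c a := MemLp.toLp_const_smul c (memLp_affine ε R a)

theorem affineL2_ae (ε R : ℝ) (a : Plane →ᵃ[ℝ] ℝ) :
    affineL2 ε R a =ᵐ[((volume : Measure Plane).restrict (disc R)).restrict (disc ε)] a :=
  (memLp_affine ε R a).coeFn_toLp

/-- The jets of the elements of `coreSpace ε R`. -/
def coreJets (ε R : ℝ) : Submodule ℝ (Jet (disc R)) :=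
  (testJets (disc R)).topologicalClosure ⊓ (LinearMap.range (affineL2 ε R)).comap
    ((LpToLpRestrictCLM Plane ℝ ℝ ((volume : Measure Plane).restrict (disc R)) 2 (disc ε)).comp
      (fn (Ω := disc R))).toLinearMap

/-- Being affine on the inner disc is a closed condition, because the affine functions form a
finite-dimensional space. -/
theorem isClosed_coreJets (ε R : ℝ) : IsClosed (coreJets ε R : Set (Jet (disc R))) := by
  refine (Submodule.isClosed_topologicalClosure _).inter ?_
  exact (Submodule.closed_of_finiteDimensional (LinearMap.range (affineL2 ε R))).preimage
    (ContinuousLinearMap.continuous _)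

theorem coreJets_le (ε R : ℝ) : coreJets ε R ≤ sobolevJets (disc R) :=
  inf_le_left.trans closure_testJets_le

theorem restrict_disc {ε R : ℝ} (hεR : ε ≤ R) :
    ((volume : Measure Plane).restrict (disc R)).restrict (disc ε) = volume.restrict (disc ε) :=
  Measure.restrict_restrict_of_subset (Metric.ball_subset_ball hεR)

theorem mem_coreSpace_iff {ε R : ℝ} (hεR : ε ≤ R) {w : L2 (disc R)} :
    w ∈ coreSpace ε R ↔ of w ∈ coreJets ε R := by
  rw [coreJets, Submodule.mem_inf, ← mem_H20_iff Metric.isOpen_ball, coreSpace, mem_ofPred_eq,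
    Submodule.mem_comap, LinearMap.mem_range]
  refine and_congr_right fun _ => exists_congr fun a => ?_
  have h := LpToLpRestrictCLM_coeFn ℝ (μ := (volume : Measure Plane).restrict (disc R))
    (p := 2) (disc ε) w
  have ha := affineL2_ae ε R a
  rw [← restrict_disc hεR]
  constructor
  · intro hw
    exact Lp.ext (ha.trans ((show _ =ᵐ[_] _ from hw).symm.trans h.symm))
  · intro hw
    refine h.symm.trans (EventuallyEq.trans ?_ ha)
    rw [hw]
    rfl

theorem fn_mem_coreSpace {ε R : ℝ} (hεR : ε ≤ R) {k : Jet (disc R)} (hk : k ∈ coreJets ε R) :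
    fn k ∈ coreSpace ε R := by
  rwa [mem_coreSpace_iff hεR, of_fn Metric.isOpen_ball (coreJets_le ε R hk)]

/-! ### The energy as a coercive quadratic form -/

/-- The inner product of `L²(Ω)` as a continuous bilinear map. -/
def innerL2 (Ω : Set Plane) : L2 Ω →L[ℝ] L2 Ω →L[ℝ] ℝ :=
  (isBoundedBilinearMap_inner (𝕜 := ℝ) (E := L2 Ω)).toContinuousLinearMap

/-- The bilinear form `∫_Ω (H : H' - ν tr H tr H')` of the Hessian components of two jets. -/
def energyForm (ν : ℝ) (Ω : Set Plane) : Jet Ω →L[ℝ] Jet Ω →L[ℝ] ℝ :=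
  (∑ i, ∑ j, (innerL2 Ω).bilinearComp (hess i j) (hess i j)) -
    ν • (innerL2 Ω).bilinearComp (∑ i, hess i i) (∑ i, hess i i)

theorem energyForm_apply (ν : ℝ) (k l : Jet Ω) :
    energyForm ν Ω k l = (∑ i, ∑ j, inner ℝ (hess i j k) (hess i j l)) -
      ν * inner ℝ (∑ i, hess i i k) (∑ i, hess i i l) := by
  simp [energyForm, innerL2, inner_add_left]

theorem energyForm_comm (ν : ℝ) (k l : Jet Ω) : energyForm ν Ω k l = energyForm ν Ω l k := by
  rw [energyForm_apply, energyForm_apply, real_inner_comm]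
  congr 1
  exact Finset.sum_congr rfl fun i _ => Finset.sum_congr rfl fun j _ => real_inner_comm _ _

theorem bulkEnergy_eq (E ν : ℝ) (u : L2 Ω) :
    bulkEnergy E ν Ω u = 1 / 2 * ((1 + ν) / E) * energyForm ν Ω (of u) (of u) := by
  have hi : ∀ f : L2 Ω, Integrable (fun x => f x ^ 2) ((volume : Measure Plane).restrict Ω) :=
    fun f => (Lp.memLp f).integrable_sq
  have hn : ∀ f : L2 Ω, inner ℝ f f = ∫ x in Ω, f x ^ 2 := fun f => by
    rw [L2.inner_def]
    simp [sq]
  have ht : ∫ x in Ω, (∑ i, weakHess Ω i i u x) ^ 2 =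
      inner ℝ (∑ i, weakHess Ω i i u) (∑ i, weakHess Ω i i u) := by
    rw [hn]
    refine integral_congr_ae ?_
    simp only [Fin.sum_univ_two]
    filter_upwards [Lp.coeFn_add (weakHess Ω 0 0 u) (weakHess Ω 1 1 u)] with x hx
    rw [hx, Pi.add_apply]
  have hti : Integrable (fun x => (∑ i, weakHess Ω i i u x) ^ 2)
      ((volume : Measure Plane).restrict Ω) :=
    (memLp_finsetSum Finset.univ fun i _ => Lp.memLp (weakHess Ω i i u)).integrable_sq
  have hHi : ∀ i, Integrable (fun x => ∑ j, weakHess Ω i j u x ^ 2)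
      ((volume : Measure Plane).restrict Ω) := fun i => integrable_finsetSum _ fun j _ => hi _
  have hH : ∫ x in Ω, ∑ i, ∑ j, weakHess Ω i j u x ^ 2 =
      ∑ i, ∑ j, inner ℝ (weakHess Ω i j u) (weakHess Ω i j u) := by
    rw [integral_finsetSum _ fun i _ => hHi i]
    refine Finset.sum_congr rfl fun i _ => ?_
    rw [integral_finsetSum _ fun j _ => hi _]
    exact Finset.sum_congr rfl fun j _ => (hn _).symm
  rw [bulkEnergy, energyForm_apply, integral_sub (integrable_finsetSum _ fun i _ => hHi i)
    (hti.const_mul ν), integral_const_mul, ht, hH]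
  rfl

/-- Pointwise `|Δw|² ≤ 2 |∇²w|²`, so that the energy density is coercive for `ν < 1/2`. -/
theorem hess_le_energyForm {ν : ℝ} (k : Jet Ω) :
    min 1 (1 - 2 * ν) * ∑ i, ∑ j, ‖hess i j k‖ ^ 2 ≤ energyForm ν Ω k k := by
  have htr : ‖∑ i, hess i i k‖ ^ 2 ≤ 2 * ∑ i, ∑ j, ‖hess i j k‖ ^ 2 := by
    have h1 : ‖∑ i, hess i i k‖ ≤ ‖hess 0 0 k‖ + ‖hess 1 1 k‖ := by
      rw [Fin.sum_univ_two]
      exact norm_add_le _ _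
    have h2 : ‖∑ i, hess i i k‖ ^ 2 ≤ (‖hess 0 0 k‖ + ‖hess 1 1 k‖) ^ 2 := by gcongr
    simp only [Fin.sum_univ_two] at *
    nlinarith [sq_nonneg (‖hess 0 0 k‖ - ‖hess 1 1 k‖), sq_nonneg ‖hess 0 1 k‖,
      sq_nonneg ‖hess 1 0 k‖]
  rw [energyForm_apply]
  simp only [real_inner_self_eq_norm_sq]
  have h0 : 0 ≤ ∑ i, ∑ j, ‖hess i j k‖ ^ 2 := by positivity
  rcases le_total ν 0 with h | h
  · have : min 1 (1 - 2 * ν) ≤ 1 := min_le_left _ _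
    nlinarith [sq_nonneg ‖∑ i, hess i i k‖]
  · have : min 1 (1 - 2 * ν) ≤ 1 - 2 * ν := min_le_right _ _
    nlinarith

/-! ### Minimization of coercive quadratic functionals -/

/-- By Lax-Milgram there is a critical point, and the functional exceeds its critical value by the
energy of the distance to the critical point. -/
theorem existsUnique_minimizer {V : Type*} [NormedAddCommGroup V] [InnerProductSpace ℝ V]
    [CompleteSpace V] {B : V →L[ℝ] V →L[ℝ] ℝ} (hB : IsCoercive B)
    (hsymm : ∀ x y, B x y = B y x) (l : V →L[ℝ] ℝ) :
    ∃! x, ∀ y, 1 / 2 * B x x + l x ≤ 1 / 2 * B y y + l y := by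
  set x₀ : V := hB.continuousLinearEquivOfBilin.symm (-(InnerProductSpace.toDual ℝ V).symm l)
  have hx₀ : ∀ y, B x₀ y = - l y := fun y => by
    rw [← hB.continuousLinearEquivOfBilin_apply, ContinuousLinearEquiv.apply_symm_apply,
      inner_neg_left, InnerProductSpace.toDual_symm_apply]
  have key : ∀ y, 1 / 2 * B y y + l y =
      1 / 2 * B x₀ x₀ + l x₀ + 1 / 2 * B (y - x₀) (y - x₀) := fun y => by
    simp only [map_sub, _root_.sub_apply, hsymm y x₀, hx₀]
    ring
  obtain ⟨C, hC, hCB⟩ := hB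
  refine ⟨x₀, fun y => ?_, fun y hy => ?_⟩
  · rw [key y]
    have : 0 ≤ B (y - x₀) (y - x₀) := le_trans (by positivity) (hCB _)
    linarith
  · have h := hy x₀
    rw [key y] at h
    have h1 : C * ‖y - x₀‖ * ‖y - x₀‖ ≤ 0 := (hCB _).trans (by linarith)
    have h2 : ‖y - x₀‖ ^ 2 ≤ 0 := by
      by_contra! h3
      nlinarith [mul_pos hC h3]
    rw [← sub_eq_zero, ← norm_eq_zero]
    exact pow_eq_zero_iff two_ne_zero |>.1 (le_antisymm h2 (sq_nonneg _))

/-- The elastic energy plus a bounded linear functional of the jet has a unique minimizer among the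
functions that are affine in the inner disc. -/
theorem existsUnique_isMinimizer {E ν ε R : ℝ} (hE : 0 < E) (hν : -1 < ν) (hν' : ν < 1 / 2)
    (hR : 0 < R) (hεR : ε ≤ R) (l : Jet (disc R) →L[ℝ] ℝ) :
    ∃! w : L2 (disc R),
      IsMinimizer (fun w => bulkEnergy E ν (disc R) w + l (of w)) (coreSpace ε R) w := by
  have hc : 0 < (1 + ν) / E := div_pos (by linarith) hE
  set K := coreJets ε R
  have : CompleteSpace K := (isClosed_coreJets ε R).completeSpace_coe
  set B : K →L[ℝ] K →L[ℝ] ℝ :=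
    (((1 + ν) / E) • energyForm ν (disc R)).bilinearComp K.subtypeL K.subtypeL
  have hBapp : ∀ x y : K, B x y = (1 + ν) / E * energyForm ν (disc R) x y := fun x y => rfl
  have hB : IsCoercive B := by
    have hm : 0 < min 1 (1 - 2 * ν) := lt_min one_pos (by linarith)
    refine ⟨(1 + ν) / E * (min 1 (1 - 2 * ν) / (16 * R ^ 4 + 4 * R ^ 2 + 1)), by positivity,
      fun k => ?_⟩
    have h1 := norm_sq_le_hess hR k.2.1
    have h2 := hess_le_energyForm (ν := ν) (k : Jet (disc R))
    rw [hBapp, mul_assoc, mul_assoc, ← sq]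
    refine mul_le_mul_of_nonneg_left (le_trans ?_ h2) hc.le
    rw [div_mul_eq_mul_div, div_le_iff₀ (by positivity), mul_assoc, mul_comm _ (_ + _ + _)]
    exact mul_le_mul_of_nonneg_left h1 hm.le
  have hval : ∀ k : K, bulkEnergy E ν (disc R) (fn k.1) + l (of (fn k.1)) =
      1 / 2 * B k k + (l.comp K.subtypeL) k := fun k => by
    rw [bulkEnergy_eq, of_fn Metric.isOpen_ball (coreJets_le ε R k.2), hBapp, ← mul_assoc]
    rfl
  obtain ⟨k, hk, huniq⟩ := existsUnique_minimizer hB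
    (fun x y => by rw [hBapp, hBapp, energyForm_comm]) (l.comp K.subtypeL)
  have hw : ∀ w ∈ coreSpace ε R, ∃ y : K, fn y.1 = w := fun w hw =>
    ⟨⟨of w, (mem_coreSpace_iff hεR).1 hw⟩, rfl⟩
  refine ⟨fn k.1, ⟨fn_mem_coreSpace hεR k.2, fun v hv => ?_⟩, ?_⟩
  · obtain ⟨y, rfl⟩ := hw v hv
    simp only [hval]
    exact hk y
  · rintro w ⟨hwc, hmin⟩
    obtain ⟨x, rfl⟩ := hw w hwc
    rw [huniq x fun y => ?_]
    have := hmin _ (fn_mem_coreSpace hεR y.2)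
    simpa only [hval] using this

/-! ### Point values and boundary integrals of functions that are affine in the inner disc -/

/-- If `u` agrees near `x` within `U` with a function that is continuous at `x`, and `U` has points
near `x`, then the point value is the value of that function. -/
theorem pointValue_eq {U V : Set Plane} {u f : Plane → ℝ} {x : Plane} (hU : IsOpen U)
    (hx : x ∈ closure U) (hV : V ∈ 𝓝 x) (hf : Continuous f)
    (huf : ∀ᵐ y ∂((volume : Measure Plane).restrict (V ∩ U)), u y = f y) :
    pointValue U u x = f x := by
  refine Tendsto.limUnder_eq (Metric.tendsto_nhds.2 fun δ hδ => ?_)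
  obtain ⟨r₁, hr₁, hf₁⟩ := Metric.continuousAt_iff.1 hf.continuousAt (δ / 2) (half_pos hδ)
  obtain ⟨r₂, hr₂, hV₂⟩ := Metric.mem_nhds_iff.1 hV
  filter_upwards [Ioo_mem_nhdsGT (lt_min hr₁ hr₂)] with r hr
  have hsub : Metric.ball x r ∩ U ⊆ V ∩ U := inter_subset_inter_left _
    ((Metric.ball_subset_ball (hr.2.le.trans (min_le_right _ _))).trans hV₂)
  have hne : (Metric.ball x r ∩ U).Nonempty :=
    mem_closure_iff_nhds.1 hx _ (Metric.ball_mem_nhds x hr.1)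
  have h0 : (volume : Measure Plane) (Metric.ball x r ∩ U) ≠ 0 :=
    ((Metric.isOpen_ball.inter hU).measure_pos _ hne).ne'
  have htop : (volume : Measure Plane) (Metric.ball x r ∩ U) ≠ ⊤ :=
    ((measure_mono inter_subset_left).trans_lt measure_ball_lt_top).ne
  have hae : ∀ᵐ y ∂((volume : Measure Plane).restrict (Metric.ball x r ∩ U)), u y = f y :=
    ae_mono (Measure.restrict_mono hsub le_rfl) huf
  have hint : IntegrableOn f (Metric.ball x r ∩ U) :=
    (hf.continuousOn.integrableOn_compact (isCompact_closedBall x r)).mono_set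
      (inter_subset_left.trans Metric.ball_subset_closedBall)
  have hmem : ⨍ y in Metric.ball x r ∩ U, f y ∈ Metric.closedBall (f x) (δ / 2) := by
    refine (convex_closedBall _ _).set_average_mem Metric.isClosed_closedBall h0 htop ?_ hint
    filter_upwards [ae_restrict_mem (Metric.isOpen_ball.inter hU).measurableSet] with y hy
    exact (hf₁ ((Metric.mem_ball.1 hy.1).trans (hr.2.trans_le (min_le_left _ _)))).le
  rw [average_congr hae]
  exact (Metric.mem_closedBall.1 hmem).trans_lt (half_lt_self hδ)

/-- Where a function is affine, so that its classical derivative is constant, its weak partial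
derivatives are the same constants. -/
theorem isWeakPartial_affine {ε R : ℝ} (hεR : ε ≤ R) {i : Fin 2} {w g : L2 (disc R)}
    (hg : IsWeakPartial (disc R) i w g) {a : Plane →ᵃ[ℝ] ℝ}
    (ha : ∀ᵐ x ∂((volume : Measure Plane).restrict (disc ε)), w x = a x) :
    ∀ᵐ x ∂((volume : Measure Plane).restrict (disc ε)), g x = a.linear (e i) := by
  have hsub : disc ε ⊆ disc R := Metric.ball_subset_ball hεR
  have hm : MeasurableSet (disc ε) := Metric.isOpen_ball.measurableSet
  have hac : ContDiff ℝ 1 a := by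
    have : (a : Plane → ℝ) = fun x => a.linear x + a 0 := by
      ext x
      simpa using a.map_vadd 0 x
    rw [this]
    exact (LinearMap.toContinuousLinearMap a.linear).contDiff.add contDiff_const
  have had : ∀ x, fderiv ℝ a x (e i) = a.linear (e i) := fun x => by
    have : (a : Plane → ℝ) = fun x => LinearMap.toContinuousLinearMap a.linear x + a 0 := by
      ext x
      simpa using a.map_vadd 0 x
    rw [this, fderiv_add_const, ContinuousLinearMap.fderiv]
    rfl
  rw [ae_restrict_iff' hm]
  have hloc : LocallyIntegrableOn (fun x => g x - a.linear (e i)) (disc ε) :=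
    ((locallyIntegrableOn_L2 g).mono_set hsub).sub (locallyIntegrableOn_const _)
  have := Metric.isOpen_ball.ae_eq_zero_of_integral_contDiff_smul_eq_zero hloc ?_
  · filter_upwards [this] with x hx hxε
    exact sub_eq_zero.1 (hx hxε)
  intro φ h1 h2 h3
  have hφ : IsTest (disc ε) φ := ⟨h1, h2, h3⟩
  have hφR := hφ.mono hsub
  have e1 := hg φ hφR
  have hres : ∀ {f : Plane → ℝ} {ψ : Plane → ℝ}, IsTest (disc ε) ψ →
      ∫ x in disc R, f x * ψ x = ∫ x in disc ε, f x * ψ x := fun {f ψ} hψ => by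
    rw [setIntegral_eq_of_subset_of_forall_sdiff_eq_zero Metric.isOpen_ball.measurableSet hsub]
    intro x hx
    simp [hψ.eq_zero_of_notMem hx.2]
  have e2 : ∫ x in disc R, w x * fderiv ℝ φ x (e i) = - ∫ x, a.linear (e i) * φ x := by
    rw [hres (hφ.partialDeriv i)]
    have : ∫ x in disc ε, w x * fderiv ℝ φ x (e i) = ∫ x in disc ε, a x * fderiv ℝ φ x (e i) := by
      refine integral_congr_ae ?_
      filter_upwards [ha] with x hx
      rw [hx]
    rw [this, setIntegral_eq_integral_of_forall_compl_eq_zero, hφ.integral_mul_partialDeriv hac]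
    · simp_rw [had]
    · intro x hx
      simp [(hφ.partialDeriv i).eq_zero_of_notMem hx]
  have e3 : ∫ x in disc R, g x * φ x = ∫ x in disc R, a.linear (e i) * φ x := by
    rw [e2, neg_inj] at e1
    rw [← e1, setIntegral_eq_integral_of_forall_compl_eq_zero]
    intro x hx
    simp [hφR.eq_zero_of_notMem hx]
  rw [← setIntegral_eq_integral_of_forall_compl_eq_zero (s := disc R)]
  · have : ∫ x in disc R, φ x • (g x - a.linear (e i)) =
        ∫ x in disc R, (g x * φ x - a.linear (e i) * φ x) := by
      congr 1
      ext x
      simp only [smul_eq_mul]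
      ring
    rw [this, integral_sub, e3, sub_self]
    · exact (Lp.memLp g).integrable_mul hφR.memLp
    · exact (hφR.integrable_mul continuous_const).integrableOn
  · intro x hx
    simp [hφR.eq_zero_of_notMem hx]

open scoped Pointwise in
/-- The length of circles is proportional to the radius, by scaling. -/
theorem hausdorffMeasure_real_sphere {r : ℝ} (hr : 0 < r) :
    (Measure.hausdorffMeasure 1 : Measure Plane).real (Metric.sphere 0 r) =
      r * (Measure.hausdorffMeasure 1 : Measure Plane).real (Metric.sphere 0 1) := by
  have h : Metric.sphere (0 : Plane) r = r • Metric.sphere (0 : Plane) 1 := by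
    rw [smul_sphere' hr.ne', smul_zero, Real.norm_of_nonneg hr.le, mul_one]
  rw [h, Measure.real, Measure.hausdorffMeasure_smul₀ zero_le_one hr.ne', NNReal.rpow_one,
    ENNReal.smul_def, smul_eq_mul, ENNReal.toReal_mul, Measure.real]
  simp [abs_of_pos hr]

/-- The weight of `s ∂₁a` in the functionals.  It is equal to `1`, as the unit circle has length
`2π`, but this value plays no role. -/
def circleRatio : ℝ :=
  (Measure.hausdorffMeasure 1 : Measure Plane).real (Metric.sphere 0 1) / (2 * Real.pi)

theorem circle_mean {r : ℝ} (hr : 0 < r) (s c : ℝ) {f : Plane → ℝ}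
    (hf : ∀ x ∈ Metric.sphere (0 : Plane) r, f x = c) :
    s / (2 * Real.pi * r) * ∫ x in Metric.sphere (0 : Plane) r, f x
      ∂(Measure.hausdorffMeasure 1) = s * circleRatio * c := by
  rw [setIntegral_congr_fun Metric.isClosed_sphere.measurableSet hf, setIntegral_const,
    hausdorffMeasure_real_sphere hr, circleRatio, smul_eq_mul]
  field_simp

theorem dipoleFunctional_eq {E ν s ε R h : ℝ} (hh : 0 < h) (hhε : h < ε) (hεR : ε ≤ R)
    {w : L2 (disc R)} {a : Plane →ᵃ[ℝ] ℝ}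
    (ha : ∀ᵐ x ∂((volume : Measure Plane).restrict (disc ε)), w x = a x) :
    dipoleFunctional E ν s ε R h w =
      bulkEnergy E ν (disc R) w + s * circleRatio * a.linear (e 0) := by
  have hpv : ∀ y ∈ disc ε, pointValue (disc R) w y = a y := fun y hy =>
    pointValue_eq (V := disc ε) Metric.isOpen_ball
      (subset_closure (Metric.ball_subset_ball hεR hy)) (Metric.isOpen_ball.mem_nhds hy)
      a.continuous_of_finiteDimensional
      (ae_mono (Measure.restrict_mono inter_subset_left le_rfl) ha)
  rw [dipoleFunctional, circle_mean (sub_pos.2 hhε)]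
  intro x hx
  have hx' : ‖x‖ = ε - h := by simpa using hx
  have hn : ‖(h / 2) • e 0‖ = h / 2 := by
    rw [norm_smul, e]
    simp [abs_of_pos hh]
  have m1 : x + (h / 2) • e 0 ∈ disc ε := by
    rw [mem_ball_zero_iff]
    linarith [norm_add_le x ((h / 2) • e 0)]
  have m2 : x - (h / 2) • e 0 ∈ disc ε := by
    rw [mem_ball_zero_iff]
    linarith [norm_sub_le x ((h / 2) • e 0)]
  rw [hpv _ m1, hpv _ m2, div_eq_iff hh.ne']
  have hsub := a.linearMap_vsub (x + (h / 2) • e 0) (x - (h / 2) • e 0)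
  have hv : (x + (h / 2) • e 0) -ᵥ (x - (h / 2) • e 0) = h • e 0 := by
    rw [vsub_eq_sub]
    module
  rw [hv, map_smul, vsub_eq_sub, smul_eq_mul] at hsub
  rw [← hsub, mul_comm]

theorem limitFunctional_eq {E ν s ε R : ℝ} (hε : 0 < ε) (hεR : ε ≤ R)
    {w : L2 (disc R)} (hw : w ∈ H2 (disc R)) {a : Plane →ᵃ[ℝ] ℝ}
    (ha : ∀ᵐ x ∂((volume : Measure Plane).restrict (disc ε)), w x = a x) :
    limitFunctional E ν s ε R w =
      bulkEnergy E ν (disc R) w + s * circleRatio * a.linear (e 0) := by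
  rw [limitFunctional, circle_mean hε]
  intro x hx
  refine pointValue_eq (V := univ) (f := fun _ => a.linear (e 0)) Metric.isOpen_ball ?_ univ_mem
    continuous_const ?_
  · rw [disc, closure_ball _ hε.ne']
    exact Metric.sphere_subset_closedBall hx
  · rw [univ_inter]
    exact isWeakPartial_affine hεR (hw 0).1 ha

/-- On the competitors the dipole and the limit functional coincide, whatever the dipole width `h`. -/
theorem dipoleFunctional_eq_limitFunctional {E ν s ε R h : ℝ} (hh : 0 < h) (hhε : h < ε)
    (hεR : ε ≤ R) {w : L2 (disc R)} (hw : w ∈ coreSpace ε R) :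
    dipoleFunctional E ν s ε R h w = limitFunctional E ν s ε R w := by
  obtain ⟨hw, a, ha⟩ := hw
  rw [dipoleFunctional_eq hh hhε hεR ha, limitFunctional_eq (hh.trans hhε) hεR hw.1 ha]

/-- The load `w ↦ s ∂₁a`, written as a multiple of the integral of `∂₁w` over the inner disc: in
this form it is a bounded linear functional of the jet of `w`. -/
def load (s ε R : ℝ) : Jet (disc R) →L[ℝ] ℝ :=
  (s * circleRatio / (volume : Measure Plane).real (disc ε)) •
    (innerSL ℝ (indicatorConstLp 2 (μ := (volume : Measure Plane).restrict (disc R))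
      (s := disc ε) Metric.isOpen_ball.measurableSet (measure_ne_top _ _) (1 : ℝ))).comp (grad 0)

theorem limitFunctional_eq_load {E ν s ε R : ℝ} (hε : 0 < ε) (hεR : ε ≤ R)
    {w : L2 (disc R)} (hw : w ∈ coreSpace ε R) :
    limitFunctional E ν s ε R w = bulkEnergy E ν (disc R) w + load s ε R (of w) := by
  obtain ⟨hw, a, ha⟩ := hw
  have hvol : (volume : Measure Plane).real (disc ε) ≠ 0 :=
    (ENNReal.toReal_pos (Metric.measure_ball_pos _ _ hε).ne' measure_ball_lt_top.ne).ne'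
  have hint : ∫ x in disc ε, (grad 0 (of w)) x ∂((volume : Measure Plane).restrict (disc R)) =
      (volume : Measure Plane).real (disc ε) * a.linear (e 0) := by
    have hae := isWeakPartial_affine hεR (hw.1 0).1 ha
    rw [restrict_disc hεR]
    refine (integral_congr_ae hae).trans ?_
    rw [setIntegral_const, smul_eq_mul]
  rw [limitFunctional_eq hε hεR hw.1 ha, load, _root_.smul_apply,
    ContinuousLinearMap.comp_apply, innerSL_apply_apply, L2.inner_indicatorConstLp_one, hint,
    smul_eq_mul]
  field_simp

theorem IsMinimizer.congr {X : Type*} {J J' : X → ℝ} {S : Set X} (h : ∀ x ∈ S, J x = J' x)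
    {w : X} (hw : IsMinimizer J S w) : IsMinimizer J' S w :=
  ⟨hw.1, fun v hv => by rw [← h w hw.1, ← h v hv]; exact hw.2 v hv⟩

end Dipole

end

open Dipole

theorem proposition3p5 (E ν s ε R : ℝ) (hE : 0 < E) (hν : -1 < ν) (hν' : ν < 1 / 2)
    (hs : s ≠ 0) (hε : 0 < ε) (hεR : ε < R) :
    (∀ h : ℝ, 0 < h → h < ε →
      ∃! w : L2 (disc R), IsMinimizer (dipoleFunctional E ν s ε R h) (coreSpace ε R) w) ∧
    (∃! w : L2 (disc R), IsMinimizer (limitFunctional E ν s ε R) (coreSpace ε R) w) ∧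
    ∀ (W : ℝ → L2 (disc R)) (W₀ : L2 (disc R)),
      (∀ h : ℝ, 0 < h → h < ε →
        IsMinimizer (dipoleFunctional E ν s ε R h) (coreSpace ε R) (W h)) →
      IsMinimizer (limitFunctional E ν s ε R) (coreSpace ε R) W₀ →
      Tendsto (fun h => h2Norm (disc R) (W h - W₀)) (𝓝[>] 0) (𝓝 0) ∧
      Tendsto (fun h => dipoleFunctional E ν s ε R h (W h)) (𝓝[>] 0)
        (𝓝 (limitFunctional E ν s ε R W₀)) := by
  have hlim : ∃! w : L2 (disc R),
      IsMinimizer (limitFunctional E ν s ε R) (coreSpace ε R) w := by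
    obtain ⟨w, hw, huniq⟩ := existsUnique_isMinimizer hE hν hν' (hε.trans hεR) hεR.le (load s ε R)
    have heq : ∀ v ∈ coreSpace ε R, limitFunctional E ν s ε R v =
        bulkEnergy E ν (disc R) v + load s ε R (Jet.of v) := fun v hv =>
      limitFunctional_eq_load hε hεR.le hv
    exact ⟨w, hw.congr fun v hv => (heq v hv).symm, fun v hv => huniq v (hv.congr heq)⟩
  have heq : ∀ h : ℝ, 0 < h → h < ε → ∀ v ∈ coreSpace ε R,
      dipoleFunctional E ν s ε R h v = limitFunctional E ν s ε R v := fun h hh hhε v hv =>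
    dipoleFunctional_eq_limitFunctional hh hhε hεR.le hv
  refine ⟨fun h hh hhε => ?_, hlim, fun W W₀ hW hW₀ => ?_⟩
  · obtain ⟨w, hw, huniq⟩ := hlim
    exact ⟨w, hw.congr fun v hv => (heq h hh hhε v hv).symm,
      fun v hv => huniq v (hv.congr (heq h hh hhε))⟩
  · have hWeq : ∀ᶠ h in 𝓝[>] (0 : ℝ), W h = W₀ ∧
        dipoleFunctional E ν s ε R h (W h) = limitFunctional E ν s ε R W₀ := by
      filter_upwards [Ioo_mem_nhdsGT hε] with h hh
      have h1 : W h = W₀ := hlim.unique ((hW h hh.1 hh.2).congr (heq h hh.1 hh.2)) hW₀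
      exact ⟨h1, by rw [h1, heq h hh.1 hh.2 W₀ hW₀.1]⟩
    constructor
    · refine tendsto_const_nhds.congr' ?_
      filter_upwards [hWeq] with h hh
      rw [hh.1, sub_self, ← Jet.norm_of, ← map_zero (Jet.fn (Ω := disc R)),
        of_fn Metric.isOpen_ball (zero_mem _), norm_zero]
    · refine tendsto_const_nhds.congr' ?_
      filter_upwards [hWeq] with h hh
      exact hh.2.symm
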